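/- Formulas are built from propositional variables $p_0,p_1,\dots$ and $\bot$ by means of $\to$, $\Box$ and $\Box^+$, with $\neg A:=A\to\bot$ and $A\wedge B:=\neg(A\to\neg B)$. The axioms of the logic $\mathsf{K}^+$ are all formulas of the following forms: (i) classical propositional tautologies (in this language, formulas $\Box A$ and $\Box^+A$ being treated as atoms); (ii) $\Box(A\to B)\to(\Box A\to\Box B)$; (iii) $\Box^+(A\to B)\to(\Box^+A\to\Box^+B)$; (iv) $\Box^+A\to\Box A\wedge\Box\Box^+A$; (v) $\Box A\wedge\Box^+(A\to\Box A)\to\Box^+A$. An *$\omega$-derivation* is a well-founded tree whose nodes are marked by formulas and which is constructed according to the rules (mp): from $A$ and $A\to B$ infer $B$; (nec): from $A$ infer $\Box^+A$; and ($\omega$): from $B_0\to\Box(A\wedge B_1)$, $B_1\to\Box(A\wedge B_2)$, $B_2\to\Box(A\wedge B_3)$, $\dots$ infer $B_0\to\Box^+A$. The leaves may be marked by arbitrary formulas. In the rule ($\omega$), all premises except the leftmost one are called *boxed*. An *assumption leaf* is a leaf that is not marked by an axiom. An assumption leaf is *boxed* if the path from the root to it passes through an application of (nec) or through a boxed premise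 of an application of ($\omega$). For sets of formulas $\Sigma,\Gamma$ and a formula $A$, write $\Sigma;\Gamma\vdash_\omega A$ if there is an $\omega$-derivation with root marked by $A$ in which every boxed assumption leaf is marked by a formula from $\Sigma$ and every non-boxed assumption leaf is marked by a formula from $\Gamma$. Write $\Sigma;\Gamma\vdash A$ if such an $\omega$-derivation can be chosen without applications of the rule ($\omega$). **Proposition.** Let $\Sigma$ be a finite set of formulas, $\Gamma$ an arbitrary set of formulas and $A$ a formula. If $\Sigma;\Gamma\vdash_\omega A$, then $\Sigma;\Gamma\vdash A$. -/

import Mathlib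

namespace KPlus

/-- Formulas of the bimodal logic `K⁺`: `box` is `□` and `plus` is `□⁺`. -/
inductive Fm : Type
  | var (n : ℕ) : Fm
  | bot : Fm
  | imp (A B : Fm) : Fm
  | box (A : Fm) : Fm
  | plus (A : Fm) : Fm

namespace Fm

/-- `¬ A := A → ⊥`. -/
def neg (A : Fm) : Fm := imp A bot

/-- `A ∧ B := ¬ (A → ¬ B)`. -/
def and (A B : Fm) : Fm := neg (imp A (neg B))

/-- Classical truth value of a formula, where the propositional variables and the formulas
`□ A`, `□⁺ A` are treated as atoms, with truth values given by `v`. -/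
def Eval (v : Fm → Prop) : Fm → Prop
  | var n => v (var n)
  | bot => False
  | imp A B => Eval v A → Eval v B
  | box A => v (box A)
  | plus A => v (plus A)

/-- Tautologies of classical propositional logic in the language of `K⁺`
(equivalently, substitution instances of purely propositional tautologies). -/
def Tautology (A : Fm) : Prop := ∀ v : Fm → Prop, Eval v A

end Fm

open Fm

/-- The axioms of `K⁺`. -/
inductive IsAxiom : Fm → Prop
  | taut (A : Fm) (h : Tautology A) : IsAxiom A
  | boxK (A B : Fm) : IsAxiom (imp (box (imp A B)) (imp (box A) (box B)))
  | plusK (A B : Fm) : IsAxiom (imp (plus (imp A B)) (imp (plus A) (plus B)))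
  | unfold (A : Fm) : IsAxiom (imp (plus A) (and (box A) (box (plus A))))
  | ind (A : Fm) : IsAxiom (imp (and (box A) (plus (imp A (box A)))) (plus A))

/-- `ω`-derivations with the root marked by a given formula: well-founded trees built by the
rules (mp), (nec) and (ω) from leaves, which may be marked by arbitrary formulas. -/
inductive OmegaDerivation : Fm → Type
  | leaf (A : Fm) : OmegaDerivation A
  | mp (A B : Fm) (d : OmegaDerivation A) (e : OmegaDerivation (imp A B)) : OmegaDerivation B
  | nec (A : Fm) (d : OmegaDerivation A) : OmegaDerivation (plus A)
  | omega (A : Fm) (B : ℕ → Fm)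
      (d : ∀ n : ℕ, OmegaDerivation (imp (B n) (box (and A (B (n + 1)))))) :
      OmegaDerivation (imp (B 0) (plus A))

namespace OmegaDerivation

/-- The formulas marking the assumption leaves (the leaves not marked by an axiom). -/
def assumptions : {C : Fm} → OmegaDerivation C → Set Fm
  | _, leaf A => {D | D = A ∧ ¬ IsAxiom A}
  | _, mp _ _ d e => d.assumptions ∪ e.assumptions
  | _, nec _ d => d.assumptions
  | _, omega _ _ d => ⋃ n : ℕ, (d n).assumptions

/-- The formulas marking the boxed assumption leaves: those assumption leaves for which the path
from the root passes through an application of (nec), or through a premise other than the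
leftmost one of an application of (ω). -/
def boxedAssumptions : {C : Fm} → OmegaDerivation C → Set Fm
  | _, leaf _ => ∅
  | _, mp _ _ d e => d.boxedAssumptions ∪ e.boxedAssumptions
  | _, nec _ d => d.assumptions
  | _, omega _ _ d => (d 0).boxedAssumptions ∪ ⋃ n : ℕ, (d (n + 1)).assumptions

/-- The formulas marking the assumption leaves that are not boxed. -/
def nonboxedAssumptions : {C : Fm} → OmegaDerivation C → Set Fm
  | _, leaf A => {D | D = A ∧ ¬ IsAxiom A}
  | _, mp _ _ d e => d.nonboxedAssumptions ∪ e.nonboxedAssumptions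
  | _, nec _ _ => ∅
  | _, omega _ _ d => (d 0).nonboxedAssumptions

/-- The derivation contains no application of the rule (ω). -/
def OmegaFree : {C : Fm} → OmegaDerivation C → Prop
  | _, leaf _ => True
  | _, mp _ _ d e => d.OmegaFree ∧ e.OmegaFree
  | _, nec _ d => d.OmegaFree
  | _, omega _ _ _ => False

end OmegaDerivation

/-- `S; Γ ⊢_ω A`: there is an `ω`-derivation of `A` whose boxed assumption leaves are marked by
formulas from `S` and whose non-boxed assumption leaves are marked by formulas from `Γ`. -/
def OmegaDerivable (S Γ : Set Fm) (A : Fm) : Prop :=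
  ∃ d : OmegaDerivation A, d.boxedAssumptions ⊆ S ∧ d.nonboxedAssumptions ⊆ Γ

/-- `S; Γ ⊢ A`: as `S; Γ ⊢_ω A`, by a derivation without applications of the rule (ω). -/
def Derivable (S Γ : Set Fm) (A : Fm) : Prop :=
  ∃ d : OmegaDerivation A, d.OmegaFree ∧ d.boxedAssumptions ⊆ S ∧ d.nonboxedAssumptions ⊆ Γ

end KPlus

namespace KPlus

open Fm

/-! ### Kripke semantics -/

/-! The detour is semantic. Although (ω) branches infinitely, an ω-derivation has finitely many
non-boxed assumptions, because only the leftmost premise of (ω) passes them on. As `S` is finite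
too, `A` depends on a finite set `X`: these assumptions and the formulas `plus C` with `C ∈ S`. By
soundness of (ω) on Kripke models where `plus` is read along the transitive closure
(`OmegaDerivation.sat`), `A` holds wherever `X` does.

Completeness for finite `X` (`conseq_of_forall_sat`) then gives `A` from theorems and `X` by modus
ponens alone, and such a proof unwinds into an ω-free derivation in which each `plus C` is (nec)
applied to the leaf `C`. Finiteness matters: semantic consequence is not compact here, so the
canonical model itself does not interpret `plus` correctly and has to be filtrated through a finite
set of formulas. -/

/-- Kripke satisfaction, with `□⁺` read along the transitive closure of the accessibility
relation. -/
def Sat {W : Type*} (R : W → W → Prop) (V : ℕ → W → Prop) : W → Fm → Prop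
  | w, var n => V n w
  | _, bot => False
  | w, imp A B => Sat R V w A → Sat R V w B
  | w, box A => ∀ u, R w u → Sat R V u A
  | w, plus A => ∀ u, Relation.TransGen R w u → Sat R V u A

section Soundness

variable {W : Type*} {R : W → W → Prop} {V : ℕ → W → Prop}

theorem sat_and {w : W} {A B : Fm} : Sat R V w (and A B) ↔ Sat R V w A ∧ Sat R V w B := by
  simp only [Fm.and, neg, Sat]
  tauto

theorem eval_sat (w : W) (A : Fm) : Eval (Sat R V w) A ↔ Sat R V w A := by
  induction A with
  | imp A B ihA ihB => simp only [Eval, Sat, ihA, ihB]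
  | _ => simp only [Eval, Sat]

theorem IsAxiom.sat {A : Fm} (h : IsAxiom A) (w : W) : Sat R V w A := by
  cases h with
  | taut _ h => exact (eval_sat w A).1 (h _)
  | boxK A B => exact fun h₁ h₂ u hu => h₁ u hu (h₂ u hu)
  | plusK A B => exact fun h₁ h₂ u hu => h₁ u hu (h₂ u hu)
  | unfold A =>
    exact fun h => sat_and.2
      ⟨fun u hu => h u (.single hu), fun u hu v hv => h v (.head hu hv)⟩
  | ind A =>
    intro h u hu
    obtain ⟨h₁, h₂⟩ := sat_and.1 h
    induction hu with
    | single hu => exact h₁ _ hu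
    | tail hu hv ih => exact h₂ _ hu ih _ hv

namespace OmegaDerivation

theorem boxedAssumptions_subset {C : Fm} (d : OmegaDerivation C) :
    d.boxedAssumptions ⊆ d.assumptions := by
  induction d with
  | leaf A => exact Set.empty_subset _
  | mp A B d e ihd ihe => exact Set.union_subset_union ihd ihe
  | nec A d ih => exact subset_rfl
  | omega A B d ih =>
    exact Set.union_subset ((ih 0).trans (Set.subset_iUnion (fun n => (d n).assumptions) 0))
      (Set.iUnion_subset fun n => Set.subset_iUnion (fun n => (d n).assumptions) (n + 1))

theorem nonboxedAssumptions_subset {C : Fm} (d : OmegaDerivation C) :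
    d.nonboxedAssumptions ⊆ d.assumptions := by
  induction d with
  | leaf A => exact subset_rfl
  | mp A B d e ihd ihe => exact Set.union_subset_union ihd ihe
  | nec A d ih => exact Set.empty_subset _
  | omega A B d ih => exact (ih 0).trans (Set.subset_iUnion (fun n => (d n).assumptions) 0)

theorem finite_nonboxedAssumptions {C : Fm} (d : OmegaDerivation C) :
    d.nonboxedAssumptions.Finite := by
  induction d with
  | leaf A => exact (Set.finite_singleton A).subset fun D hD => hD.1
  | mp A B d e ihd ihe => exact ihd.union ihe
  | nec A d ih => exact Set.finite_empty
  | omega A B d ih => exact ih 0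

/-- Boxed assumptions are required at all worlds strictly above `w`, a requirement inherited by
every such world; this is what lets the induction hypothesis be applied there to (nec) and to the
boxed premises. -/
theorem sat {C : Fm} (d : OmegaDerivation C) (w : W)
    (hn : ∀ D ∈ d.nonboxedAssumptions, Sat R V w D)
    (hb : ∀ D ∈ d.boxedAssumptions, Sat R V w (plus D)) : Sat R V w C := by
  induction d generalizing w with
  | leaf A =>
    by_cases hA : IsAxiom A
    · exact hA.sat w
    · exact hn A ⟨rfl, hA⟩
  | mp A B d e ihd ihe =>
    exact ihe w (fun D hD => hn D (.inr hD)) (fun D hD => hb D (.inr hD))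
      (ihd w (fun D hD => hn D (.inl hD)) (fun D hD => hb D (.inl hD)))
  | nec A d ih =>
    exact fun u hu => ih u (fun D hD => hb D (d.nonboxedAssumptions_subset hD) u hu)
      fun D hD v hv => hb D (d.boxedAssumptions_subset hD) v (hu.trans hv)
  | omega A B d ih =>
    intro h0 u hu
    have step : ∀ n v, Relation.TransGen R w v → Sat R V v (B (n + 1)) →
        Sat R V v (box (and A (B (n + 2)))) := by
      intro n v hv
      refine ih (n + 1) v (fun D hD => ?_) fun D hD x hx => ?_
      · exact hb D (.inr (Set.mem_iUnion.2 ⟨n, (d (n + 1)).nonboxedAssumptions_subset hD⟩)) v hv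
      · exact hb D (.inr (Set.mem_iUnion.2 ⟨n, (d (n + 1)).boxedAssumptions_subset hD⟩)) x
          (hv.trans hx)
    -- Follow a path from `w` to `u`: each edge uses the next premise, so `n + 1` is the length of
    -- the path.
    have key : ∃ n, Sat R V u (and A (B (n + 1))) := by
      induction hu with
      | single hu => exact ⟨0, ih 0 w hn (fun D hD => hb D (.inl hD)) h0 _ hu⟩
      | tail hu hv ihu =>
        obtain ⟨n, hn'⟩ := ihu
        exact ⟨n + 1, step n _ hu (sat_and.1 hn').2 _ hv⟩
    obtain ⟨n, hn'⟩ := key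
    exact (sat_and.1 hn').1

end OmegaDerivation

end Soundness

/-! ### Theorems of `K⁺` and maximal consistent sets -/

/-- Theorems of `K⁺`. -/
inductive Thm : Fm → Prop
  | ax {A : Fm} (h : IsAxiom A) : Thm A
  | mp {A B : Fm} (h₁ : Thm (imp A B)) (h₂ : Thm A) : Thm B
  | nec {A : Fm} (h : Thm A) : Thm (plus A)

/-- Local consequence: derivability from theorems and hypotheses by modus ponens. -/
inductive Conseq (X : Set Fm) : Fm → Prop
  | hyp {A : Fm} (h : A ∈ X) : Conseq X A
  | thm {A : Fm} (h : Thm A) : Conseq X A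
  | mp {A B : Fm} (h₁ : Conseq X (imp A B)) (h₂ : Conseq X A) : Conseq X B

theorem Thm.of_tautology {A : Fm} (h : Tautology A) : Thm A := .ax (.taut A h)

theorem Thm.box_of_plus {A : Fm} : Thm (imp (plus A) (box A)) := by
  -- The antecedent `imp bot bot` is a dummy: the unfolding axiom alone entails the conclusion
  -- propositionally.
  refine .mp (.mp (Thm.of_tautology ?_) (.ax (.unfold A))) (Thm.of_tautology (A := imp bot bot) ?_)
  · intro v
    simp only [Eval, Fm.and, neg]
    tauto
  · exact fun v h => h

theorem Thm.box {A : Fm} (h : Thm A) : Thm (box A) := .mp .box_of_plus h.nec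

namespace Conseq

variable {X Y : Set Fm} {A B : Fm}

theorem mono (hXY : X ⊆ Y) (h : Conseq X A) : Conseq Y A := by
  induction h with
  | hyp h => exact .hyp (hXY h)
  | thm h => exact .thm h
  | mp _ _ ih₁ ih₂ => exact .mp ih₁ ih₂

theorem taut (h : Tautology A) : Conseq X A := .thm (.of_tautology h)

/-- Necessitation applies only to theorems, so modus ponens is the only rule to check. -/
theorem deduction (h : Conseq (insert B X) A) : Conseq X (imp B A) := by
  have weaken : ∀ {C}, Conseq X C → Conseq X (imp B C) := fun {C} hC =>
    .mp (taut (A := imp C (imp B C)) fun v h _ => h) hC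
  induction h with
  | hyp h =>
    rcases h with rfl | h
    · exact taut fun v h => h
    · exact weaken (.hyp h)
  | thm h => exact weaken (.thm h)
  | @mp C D _ _ ih₁ ih₂ =>
    exact .mp (.mp (taut (A := imp (imp B (imp C D)) (imp (imp B C) (imp B D)))
      fun v h₁ h₂ h => h₁ h (h₂ h)) ih₁) ih₂

theorem of_chain {c : Set (Set Fm)} (hc : IsChain (· ⊆ ·) c) (hne : c.Nonempty)
    (h : Conseq (⋃₀ c) A) : ∃ Y ∈ c, Conseq Y A := by
  induction h with
  | hyp h =>
    obtain ⟨Y, hY, h⟩ := h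
    exact ⟨Y, hY, .hyp h⟩
  | thm h =>
    obtain ⟨Y, hY⟩ := hne
    exact ⟨Y, hY, .thm h⟩
  | mp _ _ ih₁ ih₂ =>
    obtain ⟨Y, hY, h₁⟩ := ih₁
    obtain ⟨Z, hZ, h₂⟩ := ih₂
    rcases hc.total hY hZ with h | h
    · exact ⟨Z, hZ, .mp (h₁.mono h) h₂⟩
    · exact ⟨Y, hY, .mp h₁ (h₂.mono h)⟩

theorem box_of_forall {M : Set Fm} (hX : ∀ C ∈ X, Conseq M (box C)) (h : Conseq X A) :
    Conseq M (box A) := by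
  induction h with
  | hyp h => exact hX _ h
  | thm h => exact .thm h.box
  | mp _ _ ih₁ ih₂ => exact .mp (.mp (.thm (.ax (.boxK _ _))) ih₁) ih₂

end Conseq

/-- Maximal consistent sets of formulas. -/
structure MCS where
  carrier : Set Fm
  closed : ∀ {A}, Conseq carrier A → A ∈ carrier
  mem_imp : ∀ {A B}, imp A B ∈ carrier ↔ (A ∈ carrier → B ∈ carrier)
  bot_notMem : bot ∉ carrier

theorem exists_MCS {X : Set Fm} {A : Fm} (h : ¬ Conseq X A) :
    ∃ M : MCS, X ⊆ M.carrier ∧ A ∉ M.carrier := by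
  -- Take `M` maximal among the sets not proving `A`; any `B` outside `M` then satisfies `M ⊢ B →
  -- A`.
  obtain ⟨M, hXM, hM⟩ := zorn_subset_nonempty {Y | ¬ Conseq Y A}
    (fun c hcs hc hne => ⟨⋃₀ c, fun h' => by
      obtain ⟨Y, hY, h'⟩ := h'.of_chain hc hne
      exact hcs hY h', fun Y hY => Set.subset_sUnion_of_mem hY⟩) X h
  have hMA : ¬ Conseq M A := hM.prop
  have hins : ∀ {B}, B ∉ M → Conseq M (imp B A) := fun {B} hB => by
    by_contra hc
    have hmem : insert B M ∈ {Y | ¬ Conseq Y A} := fun h' => hc h'.deduction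
    exact hB (hM.le_of_ge hmem (Set.subset_insert B M) (Set.mem_insert B M))
  have closed : ∀ {B}, Conseq M B → B ∈ M := fun {B} hB => by
    by_contra hc
    exact hMA (.mp (hins hc) hB)
  refine ⟨⟨M, closed, fun {B C} => ⟨fun h₁ h₂ => closed (.mp (.hyp h₁) (.hyp h₂)),
    fun hBC => ?_⟩, fun hbot => ?_⟩, hXM, fun hA => hMA (.hyp hA)⟩
  · by_cases hB : B ∈ M
    · exact closed (.mp (.taut (A := imp C (imp B C)) fun v h _ => h) (.hyp (hBC hB)))
    · by_contra hc
      -- A form of Peirce's law: `A` follows from `B → A` and `(B → C) → A`, contradicting the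
      -- choice of `M`.
      refine hMA (.mp (.mp (.taut (A := imp (imp B A) (imp (imp (imp B C) A) A)) ?_)
        (hins hB)) (hins hc))
      intro v
      simp only [Eval]
      tauto
  · exact hMA (.mp (.taut (A := imp bot A) fun v h => h.elim) (.hyp hbot))

namespace MCS

variable {A B : Fm}

theorem thm_mem (M : MCS) (h : Thm A) : A ∈ M.carrier := M.closed (.thm h)

theorem mem_and (M : MCS) : and A B ∈ M.carrier ↔ A ∈ M.carrier ∧ B ∈ M.carrier := by
  simp only [Fm.and, neg, M.mem_imp, M.bot_notMem]
  tauto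

end MCS

theorem thm_of_forall_MCS {A : Fm} (h : ∀ M : MCS, A ∈ M.carrier) : Thm A := by
  have hc : Conseq ∅ A := by
    by_contra hA
    obtain ⟨M, -, hM⟩ := exists_MCS hA
    exact hM (h M)
  clear h
  induction hc with
  | hyp h => exact h.elim
  | thm h => exact h
  | mp _ _ ih₁ ih₂ => exact .mp ih₁ ih₂

/-! ### Completeness by filtration of the canonical model -/

/-- The accessibility relation of the canonical model. -/
def CanonRel (M N : MCS) : Prop := ∀ A, box A ∈ M.carrier → A ∈ N.carrier

theorem box_mem_of_forall_canonRel {M : MCS} {A : Fm}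
    (h : ∀ N, CanonRel M N → A ∈ N.carrier) : box A ∈ M.carrier := by
  by_contra hA
  have : ¬ Conseq {C | box C ∈ M.carrier} A := fun hc =>
    hA (M.closed (hc.box_of_forall fun C hC => .hyp hC))
  obtain ⟨N, hN, hAN⟩ := exists_MCS this
  exact hAN (h N fun C hC => hN hC)

/-- Two maximal consistent sets agree on the formulas of `F`. -/
def Agree (F : Set Fm) (M N : MCS) : Prop := ∀ A ∈ F, A ∈ M.carrier ↔ A ∈ N.carrier

/-- A set of maximal consistent sets that is invariant under agreement on finitely many formulas
is defined by a single formula. -/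
theorem exists_defining_formula {F : Set Fm} (hF : F.Finite) (T : Set MCS)
    (hT : ∀ M N, Agree F M N → M ∈ T → N ∈ T) : ∃ D : Fm, ∀ M : MCS, D ∈ M.carrier ↔ M ∈ T := by
  induction F, hF using Set.Finite.induction_on generalizing T with
  | empty =>
    by_cases h : ∃ M, M ∈ T
    · obtain ⟨M, hM⟩ := h
      exact ⟨imp bot bot, fun N => ⟨fun _ => hT M N (fun A hA => hA.elim) hM,
        fun _ => N.mem_imp.2 id⟩⟩
    · exact ⟨bot, fun N => ⟨fun h' => (N.bot_notMem h').elim, fun h' => (h ⟨N, h'⟩).elim⟩⟩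
  | @insert C F _ _ ih =>
    have trans : ∀ {M N K}, Agree F M N → Agree F N K → Agree F M K :=
      fun h₁ h₂ A hA => (h₁ A hA).trans (h₂ A hA)
    -- Split `T` by the truth of `C`: `D` and `E` define the `F`-saturations of the two halves, and
    -- the required formula is "if `C` then `D` else `E`".
    obtain ⟨D, hD⟩ := ih {M | ∃ N ∈ T, C ∈ N.carrier ∧ Agree F N M}
      fun M N hMN ⟨K, hK, hC, hKM⟩ => ⟨K, hK, hC, trans hKM hMN⟩
    obtain ⟨E, hE⟩ := ih {M | ∃ N ∈ T, C ∉ N.carrier ∧ Agree F N M}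
      fun M N hMN ⟨K, hK, hC, hKM⟩ => ⟨K, hK, hC, trans hKM hMN⟩
    refine ⟨and (imp C D) (imp (neg C) E), fun M => ?_⟩
    simp only [M.mem_and, M.mem_imp, neg, M.bot_notMem, hD, hE, imp_false]
    constructor
    · rintro ⟨h₁, h₂⟩
      by_cases hC : C ∈ M.carrier
      · obtain ⟨N, hN, hCN, h⟩ := h₁ hC
        exact hT N M (Set.forall_mem_insert.2 ⟨iff_of_true hCN hC, h⟩) hN
      · obtain ⟨N, hN, hCN, h⟩ := h₂ hC
        exact hT N M (Set.forall_mem_insert.2 ⟨iff_of_false hCN hC, h⟩) hN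
    · exact fun hM => ⟨fun hC => ⟨M, hM, hC, fun _ _ => Iff.rfl⟩,
        fun hC => ⟨M, hM, hC, fun _ _ => Iff.rfl⟩⟩

/-- The accessibility relation of the least filtration of the canonical model through `F`. -/
def FiltRel (F : Set Fm) (M N : MCS) : Prop :=
  ∃ M' N', Agree F M M' ∧ CanonRel M' N' ∧ Agree F N' N

theorem CanonRel.filtRel {F : Set Fm} {M N : MCS} (h : CanonRel M N) : FiltRel F M N :=
  ⟨M, N, fun _ _ => Iff.rfl, h, fun _ _ => Iff.rfl⟩

theorem FiltRel.congr_right {F : Set Fm} {M N K : MCS} (h : FiltRel F M N) (hNK : Agree F N K) :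
    FiltRel F M K := by
  obtain ⟨M', N', h₁, h₂, h₃⟩ := h
  exact ⟨M', N', h₁, h₂, fun A hA => (h₃ A hA).trans (hNK A hA)⟩

/-- The induction axiom is applied to an invariant: the set of worlds reachable from `M` respects
agreement on `F`, hence is defined by a formula `D`. It is closed under canonical successors, so `D
→ □D` is a theorem, and `D → A` is one by hypothesis. -/
theorem plus_mem_of_forall_transGen {F : Set Fm} (hF : F.Finite) {M : MCS} {A : Fm}
    (h : ∀ N, Relation.TransGen (FiltRel F) M N → A ∈ N.carrier) : plus A ∈ M.carrier := by
  obtain ⟨D, hD⟩ := exists_defining_formula hF {N | Relation.TransGen (FiltRel F) M N} <| by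
    intro N K hNK hN
    -- Only the endpoint of the last edge has to be replaced by an agreeing world.
    rcases Relation.TransGen.tail'_iff.1 hN with ⟨L, hL, hLN⟩
    exact Relation.TransGen.tail'_iff.2 ⟨L, hL, hLN.congr_right hNK⟩
  have hstep : Thm (imp D (box D)) := thm_of_forall_MCS fun N => N.mem_imp.2 fun hN =>
    box_mem_of_forall_canonRel fun K hK => (hD K).2 (((hD N).1 hN).tail hK.filtRel)
  have hDA : Thm (imp D A) := thm_of_forall_MCS fun N => N.mem_imp.2 fun hN => h N ((hD N).1 hN)
  have hbox : box D ∈ M.carrier :=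
    box_mem_of_forall_canonRel fun N hN => (hD N).2 (.single hN.filtRel)
  have hplus : plus D ∈ M.carrier :=
    M.mem_imp.1 (M.thm_mem (.ax (.ind D))) (M.mem_and.2 ⟨hbox, M.thm_mem hstep.nec⟩)
  exact M.mem_imp.1 (M.mem_imp.1 (M.thm_mem (.ax (.plusK D A))) (M.thm_mem hDA.nec)) hplus

/-- By the unfolding axiom both `A` and `plus A` pass along each canonical edge, and both lie in
`F`, so they survive the change of representatives. -/
theorem mem_of_plus_mem {F : Set Fm} {A : Fm} (hA : A ∈ F) (hpA : plus A ∈ F) {M N : MCS}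
    (hMN : Relation.TransGen (FiltRel F) M N) (h : plus A ∈ M.carrier) : A ∈ N.carrier := by
  have step : ∀ {K L}, FiltRel F K L → plus A ∈ K.carrier →
      A ∈ L.carrier ∧ plus A ∈ L.carrier := by
    rintro K L ⟨K', L', h₁, h₂, h₃⟩ hK
    obtain ⟨h₄, h₅⟩ := K'.mem_and.1
      (K'.mem_imp.1 (K'.thm_mem (.ax (.unfold A))) ((h₁ _ hpA).1 hK))
    exact ⟨(h₃ _ hA).1 (h₂ _ h₄), (h₃ _ hpA).1 (h₂ _ h₅)⟩
  have : A ∈ N.carrier ∧ plus A ∈ N.carrier := by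
    induction hMN with
    | single hMN => exact step hMN h
    | tail _ hKN ih => exact step hKN ih.2
  exact this.1

/-- The set of subformulas of a formula. -/
def subformulas : Fm → Set Fm
  | var n => {var n}
  | bot => {bot}
  | imp A B => insert (imp A B) (subformulas A ∪ subformulas B)
  | box A => insert (box A) (subformulas A)
  | plus A => insert (plus A) (subformulas A)

theorem self_mem_subformulas (A : Fm) : A ∈ subformulas A := by
  cases A <;> simp [subformulas]

theorem finite_subformulas (A : Fm) : (subformulas A).Finite := by
  induction A with
  | var n => exact Set.finite_singleton _
  | bot => exact Set.finite_singleton _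
  | imp A B ihA ihB => exact (ihA.union ihB).insert _
  | box A ih => exact ih.insert _
  | plus A ih => exact ih.insert _

/-- The truth lemma. No quotient is taken: worlds remain maximal consistent sets, and only the
relation is blurred by agreement on `F`. -/
theorem sat_filtration_iff {F : Set Fm} (hF : F.Finite) {A : Fm} (hA : subformulas A ⊆ F)
    (M : MCS) : Sat (FiltRel F) (fun n N => var n ∈ N.carrier) M A ↔ A ∈ M.carrier := by
  induction A generalizing M with
  | var n => exact Iff.rfl
  | bot => exact ⟨False.elim, M.bot_notMem⟩
  | imp A B ihA ihB =>
    have h := (Set.subset_insert _ _).trans hA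
    rw [Sat, ihA (Set.subset_union_left.trans h), ihB (Set.subset_union_right.trans h), M.mem_imp]
  | box A ih =>
    have h := (Set.subset_insert _ _).trans hA
    simp only [Sat, ih h]
    refine ⟨fun h' => box_mem_of_forall_canonRel fun N hN => h' N hN.filtRel, ?_⟩
    rintro h' N ⟨M', N', h₁, h₂, h₃⟩
    exact (h₃ _ (h (self_mem_subformulas A))).1
      (h₂ _ ((h₁ _ (hA (self_mem_subformulas (.box A)))).1 h'))
  | plus A ih =>
    have h := (Set.subset_insert _ _).trans hA
    simp only [Sat, ih h]
    exact ⟨plus_mem_of_forall_transGen hF, fun h' N hN => mem_of_plus_mem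
      (h (self_mem_subformulas A)) (hA (self_mem_subformulas (.plus A))) hN h'⟩

/-- Completeness of `K⁺` for local consequence from finitely many hypotheses. -/
theorem conseq_of_forall_sat {X : Set Fm} (hX : X.Finite) {A : Fm}
    (h : ∀ (R : MCS → MCS → Prop) (V : ℕ → MCS → Prop) (M : MCS),
      (∀ C ∈ X, Sat R V M C) → Sat R V M A) : Conseq X A := by
  by_contra hA
  obtain ⟨M, hXM, hAM⟩ := exists_MCS hA
  -- Finiteness of `X` is needed here, since defining formulas exist only for a finite filtration
  -- set.
  have hF : (⋃ C ∈ insert A X, subformulas C).Finite :=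
    (hX.insert A).biUnion fun C _ => finite_subformulas C
  have hsub : ∀ C ∈ insert A X, subformulas C ⊆ ⋃ C ∈ insert A X, subformulas C :=
    fun C hC => Set.subset_biUnion_of_mem (u := subformulas) hC
  exact hAM ((sat_filtration_iff hF (hsub A (Set.mem_insert A X)) M).1 (h _ _ M fun C hC =>
    (sat_filtration_iff hF (hsub C (Set.mem_insert_of_mem A hC)) M).2 (hXM hC)))

/-! ### Derivations without the rule (ω) -/

section Derivable

variable {S Γ : Set Fm} {A B : Fm}

theorem Derivable.mp (h₁ : Derivable S Γ (imp A B)) (h₂ : Derivable S Γ A) : Derivable S Γ B := by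
  obtain ⟨e, he, heS, heΓ⟩ := h₁
  obtain ⟨d, hd, hdS, hdΓ⟩ := h₂
  exact ⟨.mp A B d e, ⟨hd, he⟩, Set.union_subset hdS heS, Set.union_subset hdΓ heΓ⟩

theorem Derivable.of_mem (h : A ∈ Γ) : Derivable S Γ A :=
  ⟨.leaf A, trivial, Set.empty_subset _, fun _ hD => hD.1 ▸ h⟩

theorem Derivable.plus_of_mem (h : A ∈ S) : Derivable S Γ (plus A) :=
  ⟨.nec A (.leaf A), trivial, fun _ hD => hD.1 ▸ h, Set.empty_subset _⟩

theorem Thm.exists_derivation (h : Thm A) :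
    ∃ d : OmegaDerivation A, d.OmegaFree ∧ d.assumptions = ∅ := by
  induction h with
  | @ax A h => exact ⟨.leaf A, trivial, Set.eq_empty_of_forall_notMem fun D hD => hD.2 h⟩
  | mp _ _ ih₁ ih₂ =>
    obtain ⟨e, he, he'⟩ := ih₁
    obtain ⟨d, hd, hd'⟩ := ih₂
    exact ⟨.mp _ _ d e, ⟨hd, he⟩, Set.union_empty_iff.2 ⟨hd', he'⟩⟩
  | nec _ ih =>
    obtain ⟨d, hd, hd'⟩ := ih
    exact ⟨.nec _ d, hd, hd'⟩

theorem Thm.derivable (h : Thm A) : Derivable S Γ A := by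
  obtain ⟨d, hd, hd'⟩ := h.exists_derivation
  exact ⟨d, hd, (d.boxedAssumptions_subset.trans hd'.subset).trans (Set.empty_subset _),
    (d.nonboxedAssumptions_subset.trans hd'.subset).trans (Set.empty_subset _)⟩

theorem Conseq.derivable {X : Set Fm} (hX : X ⊆ plus '' S ∪ Γ) (h : Conseq X A) :
    Derivable S Γ A := by
  induction h with
  | hyp h =>
    rcases hX h with ⟨C, hC, rfl⟩ | h
    · exact .plus_of_mem hC
    · exact .of_mem h
  | thm h => exact h.derivable
  | mp _ _ ih₁ ih₂ => exact ih₁.mp ih₂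

end Derivable

end KPlus

theorem mainTheorem7 (S Γ : Set KPlus.Fm) (A : KPlus.Fm) (hS : S.Finite)
    (h : KPlus.OmegaDerivable S Γ A) : KPlus.Derivable S Γ A := by
  obtain ⟨d, hdS, hdΓ⟩ := h
  refine KPlus.Conseq.derivable (Set.union_subset_union_right _ hdΓ)
    (KPlus.conseq_of_forall_sat ((hS.image _).union d.finite_nonboxedAssumptions)
      fun R V M hM => ?_)
  exact d.sat M (fun D hD => hM D (.inr hD))
    fun D hD => hM (KPlus.Fm.plus D) (.inl (Set.mem_image_of_mem _ (hdS hD)))
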